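/- A quasi-metric on a set $I$ is a function $\rho\colon I\times I\to\mathbb{R}$ with $\rho(x,x)=0$, $\rho(x,y)>0$ for $x\neq y$, $\rho(x,y)=\rho(y,x)$, and $\rho(x,z)\le C(\rho(x,y)+\rho(y,z))$ for some constant $C\ge 1$ and all $x,y,z\in I$. Put $B_\rho(x,r)=\{y\colon \rho(x,y)<r\}$, $\operatorname{diam}_\rho S=\sup_{x,y\in S}\rho(x,y)$ and $\rho(x,S)=\inf_{y\in S}\rho(x,y)$ (with $\inf\emptyset=\infty$). A quasi-metric $\alpha$ is power-law equivalent to $d$ if there are $\gamma>0$ and $C\ge1$ with $\frac1C\,\alpha(x,y)\le d(x,y)^\gamma\le C\,\alpha(x,y)$ for all $x,y\in I$. Let $m$ be a finite measure on a measurable space $(I,\mathbb{A})$. A good grid on it is a sequence $\mathcal{P}=(\mathcal{P}^k)_{k\ge0}$ of finite families of measurable sets of positive measure such that: each $\mathcal{P}^k$ consists of pairwise disjoint sets that cover $I$ up to a set of zero measure; each $Q\in\mathcal{P}^{k+1}$ is contained in some $P\in\mathcal{P}^k$; $\bigcup_k\mathcal{P}^k$ generates the $\sigma$-algebra $\mathbb{A}$;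 and there are $\lambda,\hat\lambda\in(0,1)$ such that $\hat\lambda\le m(Q)/m(P)\le\lambda$ whenever $Q\in\mathcal{P}^{k+1}$, $P\in\mathcal{P}^k$, $k\ge 0$ and $Q\subset P$. Proposition. Let $I$ be a compact topological space whose topology is defined by a quasi-metric $d$ (a set $U$ is open if and only if for every $x\in U$ there is $r>0$ with $B_d(x,r)\subset U$), and let $m$ be a finite Borel measure on $I$. Assume that $(I,m,d,D)$ is Ahlfors regular: $D>0$ and there are $C,r_0>0$ such that $\frac1C r^D\le m(B_d(x,r))\le C r^D$ for all $x\in I$ and $0<r\le r_0$. Then there is a good grid $\mathcal{P}=(\mathcal{P}^k)_k$ on $I$ with its Borel $\sigma$-algebra and the measure $m$ such that for every quasi-metric $\alpha$ that is power-law equivalent to $d$ the following holds. There are $\eta,C_1,C_2,C_3,C_4>0$ and $c\in(0,1)$ such that for every $k\ge1$ and every $Q\in\mathcal{P}^k$ there is $z_Q\in Q$ with $$B_\alpha(z_Q,C_1c^k)\subset Q,\qquad \operatorname{diam}_\alpha Q\le C_2c^k,$$ and, for every $t\ge0$, $$m\{x\in Q\colon \alpha(x,I\setminus Q)\le C_3\,t\,c^k\}\le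 C_4\,t^\eta\, m(Q).$$ (Here $m$ denotes the outer measure on sets that are not measurable.) -/

import Mathlib

open MeasureTheory Set
open scoped ENNReal

/-- `ρ` is a quasi-metric on `I`. (Non-negativity follows from the first two fields.) -/
structure IsQuasiMetric {I : Type*} (ρ : I → I → ℝ) : Prop where
  self_eq_zero : ∀ x, ρ x x = 0
  pos_of_ne : ∀ x y, x ≠ y → 0 < ρ x y
  symm : ∀ x y, ρ x y = ρ y x
  quasi_triangle : ∃ C : ℝ, 1 ≤ C ∧ ∀ x y z, ρ x z ≤ C * (ρ x y + ρ y z)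

/-- Two quasi-metrics are equivalent if each is bounded by a constant multiple of the other. -/
def QuasiMetricEquivalent {I : Type*} (ρ' ρ : I → I → ℝ) : Prop :=
  ∃ C : ℝ, 1 ≤ C ∧ ∀ x y, 1 / C * ρ' x y ≤ ρ x y ∧ ρ x y ≤ C * ρ' x y

/-- `ρ'` is power-law equivalent to `ρ` if it is equivalent to `ρ ^ γ` for some `γ > 0`. -/
def PowerLawEquivalent {I : Type*} (ρ' ρ : I → I → ℝ) : Prop :=
  ∃ γ : ℝ, 0 < γ ∧ QuasiMetricEquivalent ρ' (fun x y => ρ x y ^ γ)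

/-- The quasi-ball of centre `x` and radius `r`. -/
def quasiBall {I : Type*} (ρ : I → I → ℝ) (x : I) (r : ℝ) : Set I :=
  {y | ρ x y < r}

/-- The diameter of `S`, as an extended non-negative number. -/
noncomputable def quasiDiam {I : Type*} (ρ : I → I → ℝ) (S : Set I) : ℝ≥0∞ :=
  ⨆ x ∈ S, ⨆ y ∈ S, ENNReal.ofReal (ρ x y)

/-- The distance from `x` to `S`; it is `∞` when `S` is empty. -/
noncomputable def quasiDist {I : Type*} (ρ : I → I → ℝ) (x : I) (S : Set I) : ℝ≥0∞ :=
  ⨅ y ∈ S, ENNReal.ofReal (ρ x y)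

/-- The topology of `I` is the one defined by the quasi-metric `ρ`: a set is open if and only if it
contains a quasi-ball around each of its points. -/
def QuasiMetricInducesTopology {I : Type*} [TopologicalSpace I] (ρ : I → I → ℝ) : Prop :=
  ∀ U : Set I, IsOpen U ↔ ∀ x ∈ U, ∃ r : ℝ, 0 < r ∧ quasiBall ρ x r ⊆ U

/-- `r ^ D / C ≤ m (B(x, r)) ≤ C * r ^ D` for all `x` and all `0 < r ≤ r₀`. -/
def IsAhlforsRegular {I : Type*} [MeasurableSpace I] (m : Measure I) (d : I → I → ℝ) (D : ℝ) :
    Prop :=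
  0 < D ∧ ∃ C r₀ : ℝ, 0 < C ∧ 0 < r₀ ∧ ∀ (x : I) (r : ℝ), 0 < r → r ≤ r₀ →
    ENNReal.ofReal (1 / C * r ^ D) ≤ m (quasiBall d x r) ∧
      m (quasiBall d x r) ≤ ENNReal.ofReal (C * r ^ D)

/-- A good grid on a finite measure space: a nested sequence of finite partitions, up to sets of
zero measure, into measurable sets of positive measure, which generate the `σ`-algebra and in
which the ratio of the measures of a child and its parent is bounded away from `0` and `1`. -/
structure IsGoodGrid {I : Type*} [mI : MeasurableSpace I] (m : Measure I)
    (P : ℕ → Set (Set I)) : Prop where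
  finite : ∀ k, (P k).Finite
  measurableSet : ∀ k, ∀ Q ∈ P k, MeasurableSet Q
  measure_pos : ∀ k, ∀ Q ∈ P k, 0 < m Q
  disjoint : ∀ k, ∀ Q ∈ P k, ∀ W ∈ P k, Q ≠ W → Disjoint Q W
  cover : ∀ k, m (⋃₀ P k)ᶜ = 0
  nested : ∀ k, ∀ Q ∈ P (k + 1), ∃ W ∈ P k, Q ⊆ W
  generate : MeasurableSpace.generateFrom (⋃ k, P k) = mI
  ratio : ∃ lamLow lamHigh : ℝ, lamLow ∈ Ioo (0 : ℝ) 1 ∧ lamHigh ∈ Ioo (0 : ℝ) 1 ∧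
    ∀ k, ∀ Q ∈ P (k + 1), ∀ W ∈ P k, Q ⊆ W →
      lamLow ≤ m.real Q / m.real W ∧ m.real Q / m.real W ≤ lamHigh

/-! Some power `d ^ ε` is comparable with a pseudometric (`IsQuasiMetric.exists_pseudoMetricSpace`),
for which `m` is Ahlfors regular of dimension `D / ε`; the grid is built there, as in Christ's
dyadic cubes. Nets at scales proportional to `δ ^ k` form a tree by joining each point to a nearest
point of the coarser net. A point `x` is assigned to one tree vertex per level, consistently, among
those whose descendants accumulate at `x`. The resulting cells partition the whole space, contain
balls of radius `a * δ ^ k` and have diameter at most `24 * a * δ ^ k`; regularity then bounds the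
ratios of measures.

For thin layers (`IsGoodGrid.measure_layer_le`), the child containing the centre of a cell stays
away from the complement, so each generation removes a fixed fraction of the mass.

The grid is independent of `α`, which enters only through its comparability with a power of the
pseudometric. -/

/-! ### Finite nets and measurable selection -/

/-- Only finitely many membership patterns occur, so any choice depending on the pattern alone is
measurable. -/
theorem measurableSet_setOf_sep {X Y : Type*} [MeasurableSpace X] {N : Set Y} (hN : N.Finite)
    {S : Y → Set X} (hS : ∀ p ∈ N, MeasurableSet (S p)) (Φ : Set Y → Prop) :
    MeasurableSet {x | Φ {p ∈ N | x ∈ S p}} := by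
  have h : {x | Φ {p ∈ N | x ∈ S p}} =
      ⋃ A ∈ {A | A ⊆ N ∧ Φ A}, ⋂ p ∈ N, {x | x ∈ S p ↔ p ∈ A} := by
    ext x
    simp only [mem_ofPred_eq, mem_iUnion, mem_iInter, exists_prop]
    constructor
    · intro hx
      exact ⟨_, ⟨sep_subset _ _, hx⟩, fun p hp => by simp [hp]⟩
    · rintro ⟨A, ⟨hA, hΦ⟩, hx⟩
      convert hΦ
      ext p
      exact ⟨fun hp => (hx p hp.1).1 hp.2, fun hp => ⟨hA hp, (hx p (hA hp)).2 hp⟩⟩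
  rw [h]
  refine Finite.measurableSet_biUnion (hN.finite_subsets.subset fun A hA => hA.1) fun A _ => ?_
  refine Finite.measurableSet_biInter hN fun p hp => ?_
  by_cases hpA : p ∈ A
  · simpa [hpA] using hS p hp
  · simp only [hpA, iff_false]
    exact (hS p hp).compl

/-- Finite separated covering nets `N k` at the scales `r k`, with a map `par k` that sends each
point to a nearest point of `N k`. -/
structure IsNetTower {X : Type*} [PseudoMetricSpace X] (N : ℕ → Set X) (par : ℕ → X → X)
    (r : ℕ → ℝ) : Prop where
  finite : ∀ k, (N k).Finite
  cover : ∀ k x, ∃ y ∈ N k, dist x y ≤ r k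
  sep : ∀ k, ∀ x ∈ N k, ∀ y ∈ N k, x ≠ y → r k ≤ dist x y
  par_mem : ∀ k x, par k x ∈ N k
  par_nearest : ∀ k x, ∀ y ∈ N k, dist x (par k x) ≤ dist x y
  scale_pos : ∀ k, 0 < r k
  scale_le : ∀ k, 12 * r (k + 1) ≤ r k

/-- A maximal separated set covers; it is finite because the packing number is bounded by a covering
number at half the radius. -/
theorem exists_finite_separated_cover {X : Type*} [PseudoMetricSpace X] [CompactSpace X] {r : ℝ}
    (hr : 0 < r) : ∃ N : Set X, N.Finite ∧ (∀ x, ∃ y ∈ N, dist x y ≤ r) ∧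
      ∀ x ∈ N, ∀ y ∈ N, x ≠ y → r ≤ dist x y := by
  lift r to NNReal using hr.le
  have hr' : r / 2 ≠ 0 := by simpa using (NNReal.coe_pos.1 hr).ne'
  have htop : Metric.packingNumber r (univ : Set X) ≠ ⊤ := by
    obtain ⟨N, hN, hNf, hNc⟩ := Metric.exists_finite_isCover_of_isCompact hr'
      (isCompact_univ (X := X))
    have h := (Metric.packingNumber_two_mul_le_externalCoveringNumber (r / 2)
      (univ : Set X)).trans hNc.externalCoveringNumber_le_encard
    rw [mul_div_cancel₀ _ (two_ne_zero)] at h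
    exact ne_top_of_le_ne_top hNf.encard_lt_top.ne h
  refine ⟨Metric.maximalSeparatedSet r univ, ?_, fun x => ?_, fun x hx y hy hxy => ?_⟩
  · rw [← Set.encard_ne_top_iff, Metric.encard_maximalSeparatedSet htop]
    exact htop
  · obtain ⟨y, hy, hxy⟩ := Metric.isCover_maximalSeparatedSet htop (mem_univ x)
    refine ⟨y, hy, ?_⟩
    have : edist x y ≤ r := hxy
    rw [edist_nndist] at this
    exact_mod_cast this
  · have : (r : ℝ≥0∞) < edist x y := Metric.isSeparated_maximalSeparatedSet hx hy hxy
    rw [edist_nndist] at this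
    exact_mod_cast this.le

theorem exists_isNetTower (X : Type*) [PseudoMetricSpace X] [CompactSpace X] {r : ℕ → ℝ}
    (hr : ∀ k, 0 < r k) (hle : ∀ k, 12 * r (k + 1) ≤ r k) :
    ∃ (N : ℕ → Set X) (par : ℕ → X → X), IsNetTower N par r := by
  choose N hf hc hs using fun k => exists_finite_separated_cover (X := X) (hr k)
  have h : ∀ k x, ∃ p ∈ N k, ∀ y ∈ N k, dist x p ≤ dist x y := fun k x => by
    obtain ⟨y, hy, -⟩ := hc k x
    exact Set.exists_min_image (N k) (dist x) (hf k) ⟨y, hy⟩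
  choose par hp hn using h
  exact ⟨N, par, hf, hc, hs, hp, hn, hr, hle⟩

/-! ### Tree of nets and its cells -/

/-- The ancestor in the `k`-th net of a point of the `(k + n)`-th net. -/
def netAncestor {X : Type*} (par : ℕ → X → X) : ℕ → ℕ → X → X
  | _, 0, z => z
  | k, n + 1, z => par k (netAncestor par (k + 1) n z)

/-- The points which are limits of descendants of `p`, a point of the `k`-th net. -/
def netShadow {X : Type*} [PseudoMetricSpace X] (N : ℕ → Set X) (par : ℕ → X → X) (r : ℕ → ℝ)
    (k : ℕ) (p : X) : Set X :=
  {x | ∃ᶠ n in Filter.atTop, ∃ y ∈ N (k + n), netAncestor par k n y = p ∧ dist x y ≤ r (k + n)}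

/-- The point of the `k`-th net whose cell contains `x`. -/
def netAddress {X : Type*} [PseudoMetricSpace X] (N : ℕ → Set X) (par : ℕ → X → X) (r : ℕ → ℝ)
    (sel : Set X → X) : ℕ → X → X
  | 0, x => sel {p ∈ N 0 | x ∈ netShadow N par r 0 p}
  | k + 1, x => sel {p ∈ N (k + 1) | x ∈ {x | par k p = netAddress N par r sel k x} ∩
      netShadow N par r (k + 1) p}

namespace IsNetTower

variable {X : Type*} [PseudoMetricSpace X] {N : ℕ → Set X} {par : ℕ → X → X} {r : ℕ → ℝ}
  {sel : Set X → X}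

theorem scale_antitone (h : IsNetTower N par r) : Antitone r :=
  antitone_nat_of_succ_le fun k => by linarith [h.scale_pos (k + 1), h.scale_le k]

theorem netAncestor_mem (h : IsNetTower N par r) (k n : ℕ) {y : X} (hy : y ∈ N (k + n)) :
    netAncestor par k n y ∈ N k := by
  cases n with
  | zero => exact hy
  | succ n => exact h.par_mem _ _

theorem dist_par_le (h : IsNetTower N par r) (k : ℕ) (x : X) : dist x (par k x) ≤ r k := by
  obtain ⟨y, hy, hxy⟩ := h.cover k x
  exact (h.par_nearest k x y hy).trans hxy

theorem dist_netAncestor_le (h : IsNetTower N par r) (k n : ℕ) (y : X) :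
    dist y (netAncestor par k n y) ≤ 2 * r k := by
  induction n generalizing k with
  | zero => simpa [netAncestor] using (h.scale_pos k).le
  | succ n ih =>
    have h1 := ih (k + 1)
    have h2 := h.dist_par_le k (netAncestor par (k + 1) n y)
    have h3 := dist_triangle y (netAncestor par (k + 1) n y) (netAncestor par k (n + 1) y)
    simp only [netAncestor] at h3 ⊢
    linarith [h.scale_le k, h.scale_pos (k + 1)]

theorem dist_le_of_mem_netShadow (h : IsNetTower N par r) {k : ℕ} {p x : X}
    (hx : x ∈ netShadow N par r k p) : dist x p ≤ 3 * r k := by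
  obtain ⟨n, y, -, rfl, hxy⟩ := Filter.Frequently.exists hx
  have h1 := h.dist_netAncestor_le k n y
  have h2 := h.scale_antitone (Nat.le_add_right k n)
  linarith [dist_triangle x y (netAncestor par k n y)]

theorem exists_mem_netShadow (h : IsNetTower N par r) (k : ℕ) (x : X) :
    ∃ p ∈ N k, x ∈ netShadow N par r k p := by
  simp only [netShadow, mem_ofPred_eq]
  rw [← Filter.frequently_exists_finite (h.finite k)]
  refine Filter.Frequently.of_forall fun n => ?_
  obtain ⟨y, hy, hxy⟩ := h.cover (k + n) x
  exact ⟨_, h.netAncestor_mem k n hy, y, hy, rfl, hxy⟩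

/-- Pigeonhole: infinitely many approximating descendants of `p` pass through finitely many
children, so one child is used infinitely often. -/
theorem exists_child_mem_netShadow (h : IsNetTower N par r) {k : ℕ} {p x : X}
    (hx : x ∈ netShadow N par r k p) :
    ∃ j ∈ N (k + 1), par k j = p ∧ x ∈ netShadow N par r (k + 1) j := by
  suffices ∃ j ∈ N (k + 1), ∃ᶠ n in Filter.atTop, par k j = p ∧
      ∃ y ∈ N (k + 1 + n), netAncestor par (k + 1) n y = j ∧ dist x y ≤ r (k + 1 + n) by
    obtain ⟨j, hj, hjn⟩ := this
    exact ⟨j, hj, hjn.exists.choose_spec.1, hjn.mono fun n hn => hn.2⟩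
  rw [← Filter.frequently_exists_finite (h.finite (k + 1))]
  rw [netShadow, mem_ofPred_eq, ← Filter.map_add_atTop_eq_nat 1, Filter.frequently_map] at hx
  refine hx.mono ?_
  rintro n ⟨y, hy, hyp, hxy⟩
  rw [show k + (n + 1) = k + 1 + n by ring] at hy hxy
  exact ⟨_, h.netAncestor_mem (k + 1) n hy, hyp, y, hy, rfl, hxy⟩

/-- Some child `z` of `q` is within `3 * r (k + 1) ≤ r k / 4` of `x`, hence less than `r k / 2` from
`p`. Its nearest net point `q` is no farther from it, so separation forces `q = p`. This is where
the factor `12` between scales is needed. -/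
theorem eq_of_mem_netShadow (h : IsNetTower N par r) {k : ℕ} {p q x : X} (hp : p ∈ N k)
    (hq : q ∈ N k) (hx : x ∈ netShadow N par r k q) (hxp : dist x p < r k / 4) : q = p := by
  by_contra hne
  obtain ⟨z, hz, rfl, hxz⟩ := h.exists_child_mem_netShadow hx
  have h1 := h.dist_le_of_mem_netShadow hxz
  have h2 := h.par_nearest k z p hp
  have h3 := h.sep k _ hq p hp hne
  have h4 := dist_triangle_left (par k z) p z
  have h5 := dist_triangle_left z p x
  linarith [h.scale_le k]

theorem measurableSet_netShadow [MeasurableSpace X] [BorelSpace X] (h : IsNetTower N par r)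
    (k : ℕ) (p : X) : MeasurableSet (netShadow N par r k p) := by
  have hs : netShadow N par r k p = Filter.limsup (fun n => ⋃ y ∈ {y ∈ N (k + n) |
      netAncestor par k n y = p}, Metric.closedBall y (r (k + n))) Filter.atTop := by
    ext x
    simp only [netShadow, Filter.mem_limsup_iff_frequently_mem, mem_iUnion, exists_prop,
      mem_ofPred_eq, Metric.mem_closedBall, and_assoc]
  rw [hs]
  refine MeasurableSet.measurableSet_limsup fun n => ?_
  exact Finite.measurableSet_biUnion ((h.finite _).subset (sep_subset _ _)) fun y _ =>
    Metric.isClosed_closedBall.measurableSet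

variable (h : IsNetTower N par r) (hsel : ∀ S : Set X, S.Nonempty → sel S ∈ S)
include h

theorem measurableSet_netAddress [MeasurableSpace X] [BorelSpace X] (sel : Set X → X) (k : ℕ)
    (p : X) : MeasurableSet {x | netAddress N par r sel k x = p} := by
  induction k generalizing p with
  | zero =>
    exact measurableSet_setOf_sep (h.finite 0) (fun q _ => h.measurableSet_netShadow 0 q)
      fun S => sel S = p
  | succ k ih =>
    refine measurableSet_setOf_sep (h.finite (k + 1)) (fun q _ => ?_) fun S => sel S = p
    refine MeasurableSet.inter ?_ (h.measurableSet_netShadow (k + 1) q)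
    simpa [eq_comm] using ih (par k q)

include hsel

/-- Membership in the shadow is carried along because it guarantees a candidate child at the next
level. -/
theorem netAddress_mem_and (k : ℕ) (x : X) : netAddress N par r sel k x ∈ N k ∧
    x ∈ netShadow N par r k (netAddress N par r sel k x) := by
  induction k with
  | zero => exact hsel {p ∈ N 0 | x ∈ netShadow N par r 0 p} (h.exists_mem_netShadow 0 x)
  | succ k ih =>
    obtain ⟨j, hj, hjp, hjx⟩ := h.exists_child_mem_netShadow ih.2
    have := hsel {p ∈ N (k + 1) | x ∈ {x | par k p = netAddress N par r sel k x} ∩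
      netShadow N par r (k + 1) p} ⟨j, hj, hjp, hjx⟩
    exact ⟨this.1, this.2.2⟩

theorem par_netAddress (k : ℕ) (x : X) :
    par k (netAddress N par r sel (k + 1) x) = netAddress N par r sel k x := by
  obtain ⟨j, hj, hjp, hjx⟩ :=
    h.exists_child_mem_netShadow (h.netAddress_mem_and hsel k x).2
  have := hsel {p ∈ N (k + 1) | x ∈ {x | par k p = netAddress N par r sel k x} ∩
      netShadow N par r (k + 1) p} ⟨j, hj, hjp, hjx⟩
  exact this.2.1

theorem netAddress_eq {k : ℕ} {p x : X} (hp : p ∈ N k) (hx : dist x p < r k / 4) :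
    netAddress N par r sel k x = p :=
  have h' := h.netAddress_mem_and hsel k x
  h.eq_of_mem_netShadow hp h'.1 h'.2 hx

end IsNetTower

/-! ### Decay of boundary layers -/

theorem IsGoodGrid.subset_of_mem {I : Type*} [MeasurableSpace I] {m : Measure I}
    {P : ℕ → Set (Set I)} (hP : IsGoodGrid m P) {k : ℕ} {Q R : Set I} (hQ : Q ∈ P k)
    (hR : R ∈ P (k + 1)) {x : I} (hxQ : x ∈ Q) (hxR : x ∈ R) : R ⊆ Q := by
  obtain ⟨W, hW, hRW⟩ := hP.nested k R hR
  rcases eq_or_ne W Q with rfl | hne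
  · exact hRW
  · exact absurd hxQ (disjoint_left.1 (hP.disjoint k W hW Q hQ hne) (hRW hxR))

/-- In an exact grid whose cells contain balls of comparable size, the measure of the boundary
layers of a cell decays geometrically. -/
theorem IsGoodGrid.measure_layer_le {X : Type*} [PseudoMetricSpace X] [MeasurableSpace X]
    {m : Measure X} [IsFiniteMeasure m] {P : ℕ → Set (Set X)} (hP : IsGoodGrid m P)
    (hcov : ∀ k, ⋃₀ P k = univ) {a δ lam : ℝ} (ha : 0 < a) (hδ : 0 < δ) (hδ' : 48 * δ ≤ 1)
    (hlam : ∀ k, ∀ Q ∈ P (k + 1), ∀ W ∈ P k, Q ⊆ W → lam ≤ m.real Q / m.real W)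
    (hball : ∀ k, ∀ Q ∈ P k, ∃ z ∈ Q, Metric.ball z (a * δ ^ k) ⊆ Q)
    (hdiam : ∀ k, ∀ Q ∈ P k, ∀ x ∈ Q, ∀ y ∈ Q, dist x y ≤ 24 * a * δ ^ k)
    {n k : ℕ} {Q : Set X} (hQ : Q ∈ P k) {r : ℝ} (hr : 2 * δ * r ≤ a * δ ^ (k + n)) :
    m {x ∈ Q | ∃ y ∉ Q, dist x y < r} ≤ ENNReal.ofReal (1 - lam) ^ n * m Q := by
  induction n generalizing k Q with
  | zero => simpa using measure_mono (sep_subset _ _)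
  | succ n ih =>
    obtain ⟨z, hzQ, hz⟩ := hball k Q hQ
    obtain ⟨R₀, hR₀, hzR₀⟩ : ∃ R ∈ P (k + 1), z ∈ R := by
      simpa using (hcov (k + 1)).ge (mem_univ z)
    have hR₀Q : R₀ ⊆ Q := hP.subset_of_mem hQ hR₀ hzQ hzR₀
    have hδ1 : δ ≤ 1 := by linarith
    have hpow : δ ^ (k + (n + 1)) ≤ δ * δ ^ k := by
      rw [← pow_succ']
      exact pow_le_pow_of_le_one hδ.le hδ1 (by omega)
    have hr' : 2 * r ≤ a * δ ^ k := by
      have : δ * (2 * r) ≤ δ * (a * δ ^ k) := by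
        calc δ * (2 * r) ≤ a * δ ^ (k + (n + 1)) := by linarith
          _ ≤ a * (δ * δ ^ k) := by gcongr
          _ = _ := by ring
      exact le_of_mul_le_mul_left this hδ
    set c := {R ∈ P (k + 1) | R ⊆ Q ∧ R ≠ R₀} with hc
    have hcf : c.Finite := (hP.finite _).subset (sep_subset _ _)
    have hsub : {x ∈ Q | ∃ y ∉ Q, dist x y < r} ⊆
        ⋃ R ∈ c, {x ∈ R | ∃ y ∉ R, dist x y < r} := by
      rintro x ⟨hxQ, y, hyQ, hxy⟩
      obtain ⟨R, hR, hxR⟩ : ∃ R ∈ P (k + 1), x ∈ R := by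
        simpa using (hcov (k + 1)).ge (mem_univ x)
      have hRQ := hP.subset_of_mem hQ hR hxQ hxR
      simp only [mem_iUnion, exists_prop]
      refine ⟨R, ⟨hR, hRQ, ?_⟩, hxR, y, fun h => hyQ (hRQ h), hxy⟩
      -- The central child has diameter at most `a * δ ^ k / 2`, and `r` is at most that too, so a
      -- layer point in it would put `y` in the inner ball of `Q`.
      rintro rfl
      have h1 := hdiam _ R hR x hxR z hzR₀
      have h2 : a * δ ^ k ≤ dist y z := by
        by_contra! h
        exact hyQ (hz h)
      have h3 := dist_triangle_left y z x
      have h4 : 24 * a * δ ^ (k + 1) ≤ a * δ ^ k / 2 := by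
        have : 0 ≤ (1 - 48 * δ) * (a * δ ^ k) := mul_nonneg (by linarith) (by positivity)
        rw [pow_succ]
        linarith
      linarith
    have hcU : (⋃ R ∈ c, R) ⊆ Q \ R₀ := by
      refine iUnion₂_subset fun R hR x hx => ⟨hR.2.1 hx, fun hx' => ?_⟩
      exact disjoint_left.1 (hP.disjoint _ R hR.1 R₀ hR₀ hR.2.2) hx hx'
    have hcm : m (⋃ R ∈ c, R) = ∑' R : c, m (R : Set X) :=
      measure_biUnion hcf.countable (fun R hR W hW hne => hP.disjoint _ R hR.1 W hW.1 hne)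
        fun R hR => hP.measurableSet _ R hR.1
    have hdiff : m (Q \ R₀) ≤ ENNReal.ofReal (1 - lam) * m Q := by
      have hpos : 0 < m.real Q := ENNReal.toReal_pos (hP.measure_pos k Q hQ).ne' (by finiteness)
      have h1 := (le_div_iff₀ hpos).1 (hlam k R₀ hR₀ Q hQ hR₀Q)
      have h2 := measureReal_sdiff (μ := m) hR₀Q (hP.measurableSet _ _ hR₀)
      rw [← ofReal_measureReal (μ := m) (s := Q), ← ofReal_measureReal (μ := m) (s := Q \ R₀),
        ← ENNReal.ofReal_mul' hpos.le]
      exact ENNReal.ofReal_le_ofReal (by linarith)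
    calc m {x ∈ Q | ∃ y ∉ Q, dist x y < r}
        ≤ m (⋃ R ∈ c, {x ∈ R | ∃ y ∉ R, dist x y < r}) := measure_mono hsub
      _ ≤ ∑' R : c, m {x ∈ (R : Set X) | ∃ y ∉ (R : Set X), dist x y < r} :=
          measure_biUnion_le m hcf.countable _
      _ ≤ ∑' R : c, ENNReal.ofReal (1 - lam) ^ n * m (R : Set X) :=
          ENNReal.tsum_le_tsum fun R => ih R.2.1 (by rwa [show k + 1 + n = k + (n + 1) by ring])
      _ = ENNReal.ofReal (1 - lam) ^ n * m (⋃ R ∈ c, R) := by rw [ENNReal.tsum_mul_left, hcm]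
      _ ≤ ENNReal.ofReal (1 - lam) ^ n * (ENNReal.ofReal (1 - lam) * m Q) := by
          gcongr
          exact (measure_mono hcU).trans hdiff
      _ = ENNReal.ofReal (1 - lam) ^ (n + 1) * m Q := by rw [pow_succ, mul_assoc]

/-! ### The grid on a regular compact pseudometric space -/

theorem exists_isGoodGrid_of_pseudoMetric {X : Type*} [PseudoMetricSpace X] [CompactSpace X]
    [Nonempty X] [MeasurableSpace X] [BorelSpace X] (m : Measure X) [IsFiniteMeasure m]
    {A B r₀ s : ℝ} (hA : 0 < A) (hB : 0 < B) (hr₀ : 0 < r₀) (hs : 0 < s)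
    (hlow : ∀ (x : X) (r : ℝ), 0 < r → r ≤ r₀ → ENNReal.ofReal (A * r ^ s) ≤ m (Metric.ball x r))
    (hupp : ∀ (x : X) (r : ℝ), 0 < r → r ≤ r₀ → m (Metric.ball x r) ≤ ENNReal.ofReal (B * r ^ s)) :
    ∃ P : ℕ → Set (Set X), IsGoodGrid m P ∧ (∀ k, ⋃₀ P k = univ) ∧ ∃ a δ : ℝ, 0 < a ∧ 0 < δ ∧
      48 * δ ≤ 1 ∧ (∀ k, ∀ Q ∈ P k, ∃ z ∈ Q, Metric.ball z (a * δ ^ k) ⊆ Q) ∧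
      ∀ k, ∀ Q ∈ P k, ∀ x ∈ Q, ∀ y ∈ Q, dist x y ≤ 24 * a * δ ^ k := by
  -- The last condition makes the outer ball of a child have at most half the measure guaranteed to
  -- its parent's inner ball.
  obtain ⟨δ, hδ, hδ', hδs⟩ : ∃ δ : ℝ, 0 < δ ∧ 48 * δ ≤ 1 ∧ B / A * (16 * δ) ^ s ≤ 1 / 2 := by
    have ht : Filter.Tendsto (fun δ : ℝ => B / A * (16 * δ) ^ s) (nhdsWithin 0 (Ioi 0))
        (nhds 0) := by
      have : ContinuousAt (fun δ : ℝ => B / A * (16 * δ) ^ s) 0 := by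
        refine ContinuousAt.mul continuousAt_const ?_
        exact ContinuousAt.rpow_const (by fun_prop) (Or.inr hs.le)
      have h := this.tendsto
      simp only [mul_zero, Real.zero_rpow hs.ne'] at h
      exact h.mono_left nhdsWithin_le_nhds
    have h1 := ht.eventually_le_const (show (0 : ℝ) < 1 / 2 by norm_num)
    have h2 : ∀ᶠ δ : ℝ in nhdsWithin 0 (Ioi 0), δ ∈ Ioo (0 : ℝ) (1 / 48) :=
      Ioo_mem_nhdsGT (by norm_num)
    obtain ⟨δ, h3, h4⟩ := (h1.and h2).exists
    exact ⟨δ, h4.1, by linarith [h4.2], h3⟩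
  obtain ⟨a, ha, har₀⟩ : ∃ a : ℝ, 0 < a ∧ 16 * a = r₀ := ⟨r₀ / 16, by positivity, by ring⟩
  have hδ1 : δ < 1 := by linarith
  have hrpos : ∀ k : ℕ, 0 < a * δ ^ k := fun k => by positivity
  -- With the factor `4`, the inner radius `r k / 4` is `a * δ ^ k` and the outer bound `3 * r k` is
  -- `12 * (a * δ ^ k)`.
  obtain ⟨N, par, hN⟩ := exists_isNetTower X (r := fun k => 4 * (a * δ ^ k))
    (fun k => by linarith [hrpos k]) fun k => by
      have : 0 ≤ (1 - 48 * δ) * (a * δ ^ k) := mul_nonneg (by linarith) (by positivity)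
      have := hrpos k
      simp only [pow_succ]
      nlinarith
  set r : ℕ → ℝ := fun k => 4 * (a * δ ^ k) with hr
  obtain ⟨sel, hsel⟩ : ∃ sel : Set X → X, ∀ S : Set X, S.Nonempty → sel S ∈ S :=
    ⟨fun S => Classical.epsilon (· ∈ S), fun S hS => Classical.epsilon_spec hS⟩
  set f := netAddress N par r sel with hf
  have hself : ∀ k, ∀ p ∈ N k, f k p = p := fun k p hp =>
    hN.netAddress_eq hsel hp (by simpa [hr] using hrpos k)
  have hmem : ∀ k x, f k x ∈ N k := fun k x => (hN.netAddress_mem_and hsel k x).1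
  have hdist : ∀ k x, dist x (f k x) ≤ 12 * (a * δ ^ k) := fun k x => by
    have := hN.dist_le_of_mem_netShadow (hN.netAddress_mem_and hsel k x).2
    simp only [hr] at this
    linarith
  let P : ℕ → Set (Set X) := fun k => (fun p => {x | f k x = p}) '' N k
  have hcell : ∀ k x, {y | f k y = f k x} ∈ P k := fun k x => ⟨f k x, hmem k x, rfl⟩
  have hball : ∀ k, ∀ Q ∈ P k, ∃ z ∈ Q, Metric.ball z (a * δ ^ k) ⊆ Q := by
    rintro k _ ⟨p, hp, rfl⟩
    refine ⟨p, hself k p hp, fun x hx => hN.netAddress_eq hsel hp ?_⟩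
    have : dist x p < a * δ ^ k := hx
    simp only [hr]
    linarith
  have hdiam : ∀ k, ∀ Q ∈ P k, ∀ x ∈ Q, ∀ y ∈ Q, dist x y ≤ 24 * a * δ ^ k := by
    rintro k _ ⟨p, hp, rfl⟩ x hx y hy
    have h1 := hdist k x
    have h2 := hdist k y
    have hx' : f k x = p := hx
    have hy' : f k y = p := hy
    rw [hx'] at h1
    rw [hy'] at h2
    linarith [dist_triangle_right x y p]
  have hmeas : ∀ k, ∀ Q ∈ P k, MeasurableSet Q := by
    rintro k _ ⟨p, hp, rfl⟩
    exact hN.measurableSet_netAddress sel k p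
  have hpow1 : ∀ k : ℕ, δ ^ k ≤ 1 := fun k => pow_le_one₀ hδ.le hδ1.le
  have hmlow : ∀ k, ∀ Q ∈ P k, A * (a * δ ^ k) ^ s ≤ m.real Q := by
    intro k Q hQ
    obtain ⟨z, -, hz⟩ := hball k Q hQ
    have h1 := (hlow z (a * δ ^ k) (hrpos k) (by nlinarith [hpow1 k])).trans (measure_mono hz)
    exact (ENNReal.ofReal_le_iff_le_toReal (by finiteness)).1 h1
  have hmupp : ∀ k, ∀ Q ∈ P k, m.real Q ≤ B * (16 * (a * δ ^ k)) ^ s := by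
    rintro k _ ⟨p, hp, rfl⟩
    have hsub : {x | f k x = p} ⊆ Metric.ball p (16 * (a * δ ^ k)) := by
      rintro x rfl
      have := hdist k x
      have := hrpos k
      rw [Metric.mem_ball]
      linarith
    have h1 := (measure_mono hsub).trans (hupp p (16 * (a * δ ^ k)) (by linarith [hrpos k])
      (by nlinarith [hpow1 k]))
    have := hrpos k
    exact ENNReal.toReal_le_of_le_ofReal (by positivity) h1
  have hmpos : ∀ k, ∀ Q ∈ P k, 0 < m.real Q := fun k Q hQ =>
    lt_of_lt_of_le (by have := hrpos k; positivity) (hmlow k Q hQ)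
  have hcov : ∀ k, ⋃₀ P k = univ := fun k =>
    eq_univ_of_forall fun x => ⟨_, hcell k x, rfl⟩
  refine ⟨P, ?_, hcov, a, δ, ha, hδ, hδ', hball, hdiam⟩
  refine ⟨fun k => (hN.finite k).image _, hmeas, fun k Q hQ => ?_, ?_, fun k => by simp [hcov],
    ?_, ?_, ?_⟩
  · exact (ENNReal.toReal_pos_iff.1 (hmpos k Q hQ)).1
  · rintro k _ ⟨p, hp, rfl⟩ _ ⟨q, hq, rfl⟩ hne
    refine disjoint_left.2 fun x hx hy => hne ?_
    have hx' : f k x = p := hx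
    have hy' : f k x = q := hy
    rw [← hx', ← hy']
  · rintro k _ ⟨p, hp, rfl⟩
    refine ⟨{x | f k x = par k p}, ⟨par k p, hN.par_mem k p, rfl⟩, ?_⟩
    rintro x rfl
    exact (hN.par_netAddress hsel k x).symm
  · refine le_antisymm (MeasurableSpace.generateFrom_le fun Q hQ => ?_) ?_
    · obtain ⟨k, hk⟩ := mem_iUnion.1 hQ
      exact hmeas k Q hk
    · rw [BorelSpace.measurable_eq (α := X), borel]
      refine MeasurableSpace.generateFrom_le fun U hU => ?_
      -- Cell diameters tend to zero and there are only countably many cells.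
      have hUeq : U = ⋃₀ {Q | Q ∈ (⋃ k, P k) ∧ Q ⊆ U} := by
        refine Subset.antisymm (fun x hx => ?_) (sUnion_subset fun Q hQ => hQ.2)
        obtain ⟨ε, hε, hεU⟩ := Metric.isOpen_iff.1 hU x hx
        obtain ⟨k, hk⟩ := exists_pow_lt_of_lt_one (show 0 < ε / (24 * a) by positivity) hδ1
        refine ⟨_, ⟨mem_iUnion.2 ⟨k, hcell k x⟩, fun y hy => hεU ?_⟩, rfl⟩
        have := hdiam k _ (hcell k x) y hy x rfl
        rw [lt_div_iff₀ (by positivity)] at hk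
        rw [Metric.mem_ball]
        linarith
      have hc : (⋃ k, P k).Countable := countable_iUnion fun k => ((hN.finite k).image _).countable
      rw [hUeq]
      exact @MeasurableSet.sUnion X (MeasurableSpace.generateFrom (⋃ k, P k)) _
        (hc.mono (sep_subset _ _)) fun Q hQ => MeasurableSpace.measurableSet_generateFrom hQ.1
  · have hBA : ∀ k, B * (16 * (a * δ ^ (k + 1))) ^ s ≤ 1 / 2 * (A * (a * δ ^ k) ^ s) := by
      intro k
      have h1 : (16 * (a * δ ^ (k + 1))) ^ s = (16 * δ) ^ s * (a * δ ^ k) ^ s := by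
        rw [← Real.mul_rpow (by positivity) (by positivity)]
        ring_nf
      have h2 : 0 ≤ A * (a * δ ^ k) ^ s := by positivity
      calc B * (16 * (a * δ ^ (k + 1))) ^ s
          = (B / A * (16 * δ) ^ s) * (A * (a * δ ^ k) ^ s) := by
            rw [h1]; field_simp
        _ ≤ _ := by gcongr
    refine ⟨min (1 / 2) (A / B * (δ / 16) ^ s), 1 / 2, ⟨by positivity, ?_⟩, by norm_num, ?_⟩
    · exact (min_le_left _ _).trans_lt (by norm_num)
    · intro k Q hQ W hW _
      rw [div_le_iff₀ (hmpos k W hW), le_div_iff₀ (hmpos k W hW)]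
      refine ⟨?_, ?_⟩
      · calc min (1 / 2) (A / B * (δ / 16) ^ s) * m.real W
            ≤ (A / B * (δ / 16) ^ s) * (B * (16 * (a * δ ^ k)) ^ s) := by
              gcongr
              · exact min_le_right _ _
              · exact hmupp k W hW
          _ = A * ((δ / 16) ^ s * (16 * (a * δ ^ k)) ^ s) := by field_simp
          _ = A * (a * δ ^ (k + 1)) ^ s := by
              rw [← Real.mul_rpow (by positivity) (by positivity)]
              ring_nf
          _ ≤ m.real Q := hmlow (k + 1) Q hQ
      · exact (hmupp (k + 1) Q hQ).trans ((hBA k).trans (by gcongr; exact hmlow k W hW))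

/-! ### Metrization of quasi-metrics -/

theorem IsQuasiMetric.nonneg {I : Type*} {ρ : I → I → ℝ} (h : IsQuasiMetric ρ) (x y : I) :
    0 ≤ ρ x y := by
  rcases eq_or_ne x y with rfl | hne
  · exact (h.self_eq_zero x).ge
  · exact (h.pos_of_ne x y hne).le

/-- A small power of a quasi-metric is comparable with a distance. -/
theorem IsQuasiMetric.exists_pseudoMetricSpace {I : Type*} {d : I → I → ℝ} (hd : IsQuasiMetric d) :
    ∃ (_ : PseudoMetricSpace I) (ε : ℝ), 0 < ε ∧
      ∀ x y, dist x y ≤ d x y ^ ε ∧ d x y ^ ε ≤ 2 * dist x y := by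
  obtain ⟨C, hC, htri⟩ := hd.quasi_triangle
  have hlog : 0 < Real.log (2 * C) := Real.log_pos (by linarith)
  -- Chosen so that `(2 * C) ^ (2 * ε) = 2`: two uses of the quasi-triangle inequality then give the
  -- four-point inequality with constant `2` that the chain construction requires.
  set ε := Real.log 2 / (2 * Real.log (2 * C)) with hε
  have hε0 : 0 < ε := div_pos (Real.log_pos one_lt_two) (by linarith)
  have hpow : ((2 * C) * (2 * C)) ^ ε = 2 := by
    rw [Real.rpow_def_of_pos (by positivity), Real.log_mul (by positivity) (by positivity), hε]
    rw [show (Real.log (2 * C) + Real.log (2 * C)) * (Real.log 2 / (2 * Real.log (2 * C))) =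
      Real.log 2 by field_simp; ring]
    exact Real.exp_log two_pos
  have hmax : ∀ x y z, d x z ≤ 2 * C * max (d x y) (d y z) := fun x y z => by
    have h1 := htri x y z
    have h2 : d x y + d y z ≤ 2 * max (d x y) (d y z) := by
      linarith [le_max_left (d x y) (d y z), le_max_right (d x y) (d y z)]
    nlinarith
  let e : I → I → NNReal := fun x y => ⟨d x y ^ ε, Real.rpow_nonneg (hd.nonneg x y) ε⟩
  have he0 : ∀ x, e x x = 0 := fun x =>
    NNReal.eq (by
      change d x x ^ ε = 0
      rw [hd.self_eq_zero, Real.zero_rpow hε0.ne'])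
  have hes : ∀ x y, e x y = e y x := fun x y => NNReal.eq (by simp [e, hd.symm x y])
  have he4 : ∀ x₁ x₂ x₃ x₄, e x₁ x₄ ≤ 2 * max (e x₁ x₂) (max (e x₂ x₃) (e x₃ x₄)) := by
    intro x₁ x₂ x₃ x₄
    set M := max (d x₁ x₂) (max (d x₂ x₃) (d x₃ x₄)) with hM
    have hM0 : 0 ≤ M := (hd.nonneg x₁ x₂).trans (le_max_left _ _)
    have h24 : d x₂ x₄ ≤ 2 * C * M :=
      (hmax x₂ x₃ x₄).trans (by gcongr; exact le_max_right _ _)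
    have h12 : d x₁ x₂ ≤ 2 * C * M := (le_max_left _ _).trans (le_mul_of_one_le_left hM0 (by linarith))
    have h14 : d x₁ x₄ ≤ (2 * C) * (2 * C) * M := by
      rw [mul_assoc]
      exact (hmax x₁ x₂ x₄).trans (by gcongr; exact max_le h12 h24)
    have hmono : MonotoneOn (fun t : ℝ => t ^ ε) (Ici 0) :=
      Real.monotoneOn_rpow_Ici_of_exponent_nonneg hε0.le
    have hMε : M ^ ε = max (d x₁ x₂ ^ ε) (max (d x₂ x₃ ^ ε) (d x₃ x₄ ^ ε)) := by
      have n1 := hd.nonneg x₁ x₂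
      have n2 := hd.nonneg x₂ x₃
      have n3 := hd.nonneg x₃ x₄
      rw [hM, hmono.map_max n1 (mem_Ici.2 (n2.trans (le_max_left _ _))), hmono.map_max n2 n3]
    rw [← NNReal.coe_le_coe]
    push_cast
    change d x₁ x₄ ^ ε ≤ 2 * max (d x₁ x₂ ^ ε) (max (d x₂ x₃ ^ ε) (d x₃ x₄ ^ ε))
    rw [← hMε]
    calc d x₁ x₄ ^ ε ≤ ((2 * C) * (2 * C) * M) ^ ε :=
          Real.rpow_le_rpow (hd.nonneg _ _) h14 hε0.le
      _ = 2 * M ^ ε := by rw [Real.mul_rpow (by positivity) hM0, hpow]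
  exact ⟨PseudoMetricSpace.ofPreNNDist e he0 hes, ε, hε0, fun x y =>
    ⟨PseudoMetricSpace.dist_ofPreNNDist_le e he0 hes x y,
      PseudoMetricSpace.le_two_mul_dist_ofPreNNDist e he0 hes he4 x y⟩⟩

theorem isOpen_iff_of_quasiMetric_comparable {I : Type*} [TopologicalSpace I] {d : I → I → ℝ}
    (hd : IsQuasiMetric d) (htop : QuasiMetricInducesTopology d) (M : PseudoMetricSpace I) {ε : ℝ}
    (hε : 0 < ε) (hM : ∀ x y, dist x y ≤ d x y ^ ε ∧ d x y ^ ε ≤ 2 * dist x y) (U : Set I) :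
    @IsOpen I M.toUniformSpace.toTopologicalSpace U ↔ IsOpen U := by
  rw [htop U, Metric.isOpen_iff]
  refine forall₂_congr fun x _ => ⟨?_, ?_⟩
  · rintro ⟨r, hr, hU⟩
    refine ⟨r ^ ε⁻¹, Real.rpow_pos_of_pos hr _, fun y hy => hU ?_⟩
    rw [Metric.mem_ball, dist_comm]
    exact (hM x y).1.trans_lt
      ((Real.lt_rpow_inv_iff_of_pos (hd.nonneg x y) hr.le hε).1 hy)
  · rintro ⟨r, hr, hU⟩
    refine ⟨r ^ ε / 2, by positivity, fun y hy => hU ?_⟩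
    rw [Metric.mem_ball, dist_comm] at hy
    exact (Real.rpow_lt_rpow_iff (hd.nonneg x y) hr.le hε).1 (by linarith [(hM x y).2])

/-! ### Transfer to power-law equivalent quasi-metrics -/

theorem IsGoodGrid.exists_constants_of_comparable {X : Type*} [PseudoMetricSpace X]
    [MeasurableSpace X] {m : Measure X} [IsFiniteMeasure m] {P : ℕ → Set (Set X)}
    (hP : IsGoodGrid m P) (hcov : ∀ k, ⋃₀ P k = univ) {a δ : ℝ} (ha : 0 < a) (hδ : 0 < δ)
    (hδ' : 48 * δ ≤ 1) (hball : ∀ k, ∀ Q ∈ P k, ∃ z ∈ Q, Metric.ball z (a * δ ^ k) ⊆ Q)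
    (hdiam : ∀ k, ∀ Q ∈ P k, ∀ x ∈ Q, ∀ y ∈ Q, dist x y ≤ 24 * a * δ ^ k)
    {α : X → X → ℝ} {g K : ℝ} (hg : 0 < g) (hK : 0 < K)
    (hα : ∀ x y, dist x y ^ g ≤ K * α x y ∧ α x y ≤ K * dist x y ^ g) :
    ∃ η C₁ C₂ C₃ C₄ c : ℝ, 0 < η ∧ 0 < C₁ ∧ 0 < C₂ ∧ 0 < C₃ ∧ 0 < C₄ ∧ 0 < c ∧ c < 1 ∧
      ∀ k : ℕ, 1 ≤ k → ∀ Q ∈ P k,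
        (∃ z ∈ Q, quasiBall α z (C₁ * c ^ k) ⊆ Q) ∧
        quasiDiam α Q ≤ ENNReal.ofReal (C₂ * c ^ k) ∧
        ∀ t : ℝ, 0 ≤ t →
          m {x ∈ Q | quasiDist α x Qᶜ ≤ ENNReal.ofReal (C₃ * t * c ^ k)} ≤
            ENNReal.ofReal (C₄ * t ^ η) * m Q := by
  obtain ⟨lam, _, hlam, -, hratio⟩ := hP.ratio
  have hδ1 : δ < 1 := by linarith
  have hθ0 : 0 < 1 - lam := by linarith [hlam.2]
  have hθ1 : 1 - lam < 1 := by linarith [hlam.1]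
  set θ := 1 - lam with hθ
  have hη : 0 < Real.logb δ θ :=
    Real.logb_pos_of_base_lt_one hδ hδ1 hθ0 hθ1
  have hδη : δ ^ Real.logb δ θ = θ := Real.rpow_logb hδ hδ1.ne hθ0
  have hpowc : ∀ (b : ℝ) (k : ℕ), 0 ≤ b → (b * δ ^ k) ^ g = b ^ g * (δ ^ g) ^ k := fun b k hb => by
    rw [Real.mul_rpow hb (by positivity), ← Real.rpow_pow_comm hδ.le]
  have hlt : ∀ {x y : X} {b : ℝ}, 0 ≤ b → K * α x y < b ^ g → dist x y < b := fun hb h =>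
    (Real.rpow_lt_rpow_iff dist_nonneg hb hg).1 ((hα _ _).1.trans_lt h)
  -- The exponent turns the loss `θ` per generation into a power of the scale `δ`, since `δ ^
  -- Real.logb δ θ = θ`. The `2` in `2 * K` pays for the doubling below.
  refine ⟨Real.logb δ θ / g, a ^ g / K, K * (24 * a) ^ g, (a / 2) ^ g / (2 * K), 1, δ ^ g,
    by positivity, by positivity, by positivity, by positivity, one_pos, by positivity,
    Real.rpow_lt_one hδ.le hδ1 hg, fun k _ Q hQ => ⟨?_, ?_, ?_⟩⟩
  · obtain ⟨z, hzQ, hz⟩ := hball k Q hQ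
    refine ⟨z, hzQ, fun y hy => hz ?_⟩
    have hy' : α z y < a ^ g / K * (δ ^ g) ^ k := hy
    rw [Metric.mem_ball, dist_comm]
    refine hlt (by positivity) ?_
    rw [hpowc _ _ ha.le]
    rw [div_mul_eq_mul_div, lt_div_iff₀ hK] at hy'
    linarith
  · refine iSup₂_le fun x hx => iSup₂_le fun y hy => ENNReal.ofReal_le_ofReal ?_
    rw [mul_assoc, ← hpowc _ _ (by positivity)]
    refine (hα x y).2.trans ?_
    have := hdiam k Q hQ x hx y hy
    gcongr
  · have hlayer : ∀ t : ℝ, 0 < t → ∀ n : ℕ, t ^ g⁻¹ ≤ δ ^ n →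
        m {x ∈ Q | quasiDist α x Qᶜ ≤ ENNReal.ofReal ((a / 2) ^ g / (2 * K) * t * (δ ^ g) ^ k)} ≤
          ENNReal.ofReal θ ^ (n + 1) * m Q := by
      intro t ht n hn
      refine le_trans (measure_mono ?_) (hP.measure_layer_le (n := n + 1)
        (r := a / 2 * t ^ g⁻¹ * δ ^ k) hcov ha hδ hδ' (fun k Q hQ W hW h => (hratio k Q hQ W hW h).1) hball hdiam hQ ?_)
      · rintro x ⟨hxQ, hx⟩
        have hpos : 0 < (a / 2) ^ g / (2 * K) * t * (δ ^ g) ^ k := by positivity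
        -- The infimum need not be attained; doubling the bound makes it strict and yields a witness
        -- outside `Q`.
        have hx' := hx.trans_lt ((ENNReal.ofReal_lt_ofReal_iff (by positivity)).2
          (lt_two_mul_self hpos))
        simp only [quasiDist, iInf_lt_iff] at hx'
        obtain ⟨y, hyQ, hxy⟩ := hx'
        refine ⟨hxQ, y, hyQ, hlt (by positivity) ?_⟩
        have hxy' := (ENNReal.ofReal_lt_ofReal_iff (by positivity)).1 hxy
        rw [hpowc _ _ (by positivity), Real.mul_rpow (by positivity) (by positivity),
          Real.rpow_inv_rpow ht.le hg.ne']
        calc K * α x y < K * (2 * ((a / 2) ^ g / (2 * K) * t * (δ ^ g) ^ k)) := by gcongr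
          _ = _ := by field_simp
      · calc 2 * δ * (a / 2 * t ^ g⁻¹ * δ ^ k) = a * (δ * δ ^ k * t ^ g⁻¹) := by ring
          _ ≤ a * (δ * δ ^ k * δ ^ n) := by gcongr
          _ = _ := by ring
    have hθe : ENNReal.ofReal θ < 1 := by rwa [ENNReal.ofReal_lt_one]
    intro t ht
    rw [one_mul]
    rcases ht.eq_or_lt with rfl | ht
    -- The layer for `t = 0` lies in every layer with `t > 0`, so it is null.
    · have hlim : Filter.Tendsto (fun n : ℕ => ENNReal.ofReal θ ^ (n + 1) * m Q) Filter.atTop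
          (nhds 0) := by
        have h1 := (ENNReal.tendsto_pow_atTop_nhds_zero_of_lt_one hθe).comp
          (Filter.tendsto_add_atTop_nat 1)
        simpa using ENNReal.Tendsto.mul_const h1 (Or.inr (measure_ne_top m Q))
      refine (ge_of_tendsto' hlim fun n => ?_).trans zero_le
      have hn : ((δ ^ n) ^ g) ^ g⁻¹ ≤ δ ^ n := (Real.rpow_rpow_inv (by positivity) hg.ne').le
      refine le_trans (measure_mono ?_) (hlayer ((δ ^ n) ^ g) (by positivity) n hn)
      refine fun x hx => ⟨hx.1, hx.2.trans ?_⟩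
      exact ENNReal.ofReal_le_ofReal (by rw [mul_zero, zero_mul]; positivity)
    · have hτ : t ^ (Real.logb δ θ / g) = (t ^ g⁻¹) ^ Real.logb δ θ := by
        rw [← Real.rpow_mul ht.le]
        ring_nf
      rcases le_total (t ^ g⁻¹) 1 with h1 | h1
      · obtain ⟨n, hn1, hn2⟩ := exists_nat_pow_near_of_lt_one (by positivity) h1 hδ hδ1
        refine (hlayer t ht n hn2).trans ?_
        rw [← ENNReal.ofReal_pow hθ0.le, hτ]
        gcongr
        calc θ ^ (n + 1) = (δ ^ (n + 1)) ^ Real.logb δ θ := by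
              rw [← Real.rpow_pow_comm hδ.le, hδη]
          _ ≤ (t ^ g⁻¹) ^ Real.logb δ θ := by gcongr
      · refine (measure_mono (sep_subset _ _)).trans ?_
        rw [hτ]
        refine le_mul_of_one_le_left zero_le ?_
        rw [ENNReal.one_le_ofReal]
        exact Real.one_le_rpow h1 hη.le

theorem mainTheorem8 {I : Type*} [TopologicalSpace I] [CompactSpace I] [MeasurableSpace I]
    [BorelSpace I] (m : Measure I) [IsFiniteMeasure m] (d : I → I → ℝ) (D : ℝ)
    (hd : IsQuasiMetric d) (htop : QuasiMetricInducesTopology d)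
    (hreg : IsAhlforsRegular m d D) :
    ∃ P : ℕ → Set (Set I), IsGoodGrid m P ∧
      ∀ α : I → I → ℝ, IsQuasiMetric α → PowerLawEquivalent α d →
        ∃ η C₁ C₂ C₃ C₄ c : ℝ, 0 < η ∧ 0 < C₁ ∧ 0 < C₂ ∧ 0 < C₃ ∧ 0 < C₄ ∧ 0 < c ∧ c < 1 ∧
          ∀ k : ℕ, 1 ≤ k → ∀ Q ∈ P k,
            (∃ z ∈ Q, quasiBall α z (C₁ * c ^ k) ⊆ Q) ∧
            quasiDiam α Q ≤ ENNReal.ofReal (C₂ * c ^ k) ∧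
            ∀ t : ℝ, 0 ≤ t →
              m {x ∈ Q | quasiDist α x Qᶜ ≤ ENNReal.ofReal (C₃ * t * c ^ k)} ≤
                ENNReal.ofReal (C₄ * t ^ η) * m Q := by
  -- Selecting net points needs a nonempty space; on the empty one the empty grid works.
  rcases isEmpty_or_nonempty I with hI | hI
  · refine ⟨fun _ => ∅, ⟨?_, ?_, ?_, ?_, ?_, ?_, ?_, ?_⟩, fun α _ _ => ?_⟩
    · simp
    · simp
    · simp
    · simp
    · intro k
      simp [Set.eq_empty_of_isEmpty]
    · simp
    · exact MeasurableSpace.ext fun s => by simp [Set.eq_empty_of_isEmpty s]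
    · exact ⟨1 / 2, 1 / 2, by norm_num, by norm_num, by simp⟩
    · exact ⟨1, 1, 1, 1, 1, 1 / 2, by norm_num, by norm_num, by norm_num, by norm_num,
        by norm_num, by norm_num, by norm_num, by simp⟩
  obtain ⟨M, ε, hε, hM⟩ := hd.exists_pseudoMetricSpace
  obtain rfl := TopologicalSpace.ext_iff.2
    (isOpen_iff_of_quasiMetric_comparable hd htop M hε hM)
  obtain ⟨hD, C, r₀, hC, hr₀, hmeas⟩ := hreg
  -- The half leaves room for the radius `(2 * r) ^ ε⁻¹` in the upper bound.
  have hlow : ∀ (x : I) (r : ℝ), 0 < r → r ≤ (r₀ ^ ε) / 2 →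
      ENNReal.ofReal (1 / C * r ^ (D / ε)) ≤ m (Metric.ball x r) := by
    intro x r hr hrr
    have hle : r ^ ε⁻¹ ≤ r₀ :=
      (Real.rpow_inv_le_iff_of_pos hr.le hr₀.le hε).2 (by
        have : 0 < r₀ ^ ε := by positivity
        linarith)
    have h := (hmeas x (r ^ ε⁻¹) (by positivity) hle).1
    rw [← Real.rpow_mul hr.le, inv_mul_eq_div] at h
    refine h.trans (measure_mono fun y hy => ?_)
    rw [Metric.mem_ball, dist_comm]
    exact (hM x y).1.trans_lt ((Real.lt_rpow_inv_iff_of_pos (hd.nonneg x y) hr.le hε).1 hy)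
  have hupp : ∀ (x : I) (r : ℝ), 0 < r → r ≤ (r₀ ^ ε) / 2 →
      m (Metric.ball x r) ≤ ENNReal.ofReal (C * 2 ^ (D / ε) * r ^ (D / ε)) := by
    intro x r hr hrr
    have hle : (2 * r) ^ ε⁻¹ ≤ r₀ :=
      (Real.rpow_inv_le_iff_of_pos (by positivity) hr₀.le hε).2 (by linarith)
    have h := (hmeas x ((2 * r) ^ ε⁻¹) (by positivity) hle).2
    rw [← Real.rpow_mul (by positivity), inv_mul_eq_div,
      Real.mul_rpow (z := D / ε) two_pos.le hr.le, ← mul_assoc] at h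
    refine le_trans (measure_mono fun y hy => ?_) h
    rw [Metric.mem_ball, dist_comm] at hy
    exact (Real.lt_rpow_inv_iff_of_pos (hd.nonneg x y) (by positivity) hε).2
      (by linarith [(hM x y).2])
  obtain ⟨P, hP, hcov, a, δ, ha, hδ, hδ', hball, hdiam⟩ :=
    exists_isGoodGrid_of_pseudoMetric m (by positivity) (by positivity) (by positivity)
      (by positivity) hlow hupp
  refine ⟨P, hP, ?_⟩
  rintro α hα ⟨γ, hγ, K, hK, hαd⟩
  have hpow : ∀ x y, (d x y ^ ε) ^ (γ / ε) = d x y ^ γ := fun x y => by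
    rw [← Real.rpow_mul (hd.nonneg x y), mul_div_cancel₀ _ hε.ne']
  have hK0 : 0 < K := by linarith
  have h2 : (1 : ℝ) ≤ 2 ^ (γ / ε) := Real.one_le_rpow one_le_two (by positivity)
  refine hP.exists_constants_of_comparable hcov ha hδ hδ' hball hdiam (g := γ / ε)
    (K := K * 2 ^ (γ / ε)) (by positivity) (by positivity) fun x y => ⟨?_, ?_⟩
  · calc dist x y ^ (γ / ε) ≤ (d x y ^ ε) ^ (γ / ε) := by gcongr; exact (hM x y).1
      _ ≤ K * α x y := by rw [hpow]; exact (hαd x y).2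
      _ ≤ K * 2 ^ (γ / ε) * α x y := by
        have := hα.nonneg x y
        gcongr
        exact le_mul_of_one_le_right hK0.le h2
  · have h3 := (hαd x y).1
    rw [one_div, inv_mul_le_iff₀ hK0] at h3
    calc α x y ≤ K * d x y ^ γ := h3
      _ = K * (d x y ^ ε) ^ (γ / ε) := by rw [hpow]
      _ ≤ K * (2 * dist x y) ^ (γ / ε) := by
        have := Real.rpow_nonneg (hd.nonneg x y) ε
        gcongr
        exact (hM x y).2
      _ = K * 2 ^ (γ / ε) * dist x y ^ (γ / ε) := by
        rw [Real.mul_rpow two_pos.le dist_nonneg, mul_assoc]
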